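/- **Setting.** Let $N$ be a natural number and let $\mathcal X$ (state space), $\mathcal Y^i$ (observation spaces) and $\mathcal U^i$ (action spaces), $i=1,\dots,N$, be $\sigma$-compact Polish spaces with their Borel $\sigma$-algebras, $\mathcal X$ and the $\mathcal Y^i$ being non-empty and equipped with metrics that induce their topologies. The action spaces need not be compact. Write $\mathcal Y^{1:N}=\prod_i\mathcal Y^i$, $\mathcal U^{1:N}=\prod_i\mathcal U^i$. Let $P$ be a Borel probability measure on $\mathcal X\times\mathcal Y^{1:N}$, the joint law of the state $X$ and of the observations $Y^1,\dots,Y^N$, and let $c:\mathcal X\times\mathcal Y^{1:N}\times\mathcal U^{1:N}\to[0,\infty)$ be continuous (possibly unbounded). **Strategies and cost.** A *behavioral strategy* of Agent $i$ is a Markov (probability) kernel $\pi^i(du^i\mid y^i)$ from $\mathcal Y^i$ to $\mathcal U^i$. A *deterministic strategy* is a Borel map $\gamma^i:\mathcal Y^i\to\mathcal U^i$, identified with the behavioral strategy $\pi^i(\cdot\mid y^i)=\delta_{\gamma^i(y^i)}$. The expected cost of a profile $\pi^{1:N}=(\pi^1,\dots,\pi^N)$ of behavioral strategies is $$J(\pi^{1:N})=\int_{\mathcal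 X\times\mathcal Y^{1:N}}\int_{\mathcal U^{1:N}}c(x,y^{1:N},u^{1:N})\prod_{i=1}^N\pi^i(du^i\mid y^i)\,P(dx,dy^{1:N})\in[0,\infty].$$ **Class $IC(\mathcal A,\mathcal B)$.** A non-negative measurable function $\phi$ on $\mathcal A\times\mathcal B\times\mathcal C$ is in the class $IC(\mathcal A,\mathcal B)$ if at least one of the following holds: (1) for every $M>0$ and every compact $K\subset\mathcal A$ there is a compact $L\subset\mathcal B$ with $\inf_{K\times L^{\complement}\times\mathcal C}\phi\ge M$; (2) for every $M>0$ and every $a\in\mathcal A$ there are an open neighborhood $O$ of $a$ and a compact $L\subset\mathcal B$ with $\inf_{O\times L^{\complement}\times\mathcal C}\phi\ge M$. (An infimum over the empty set is $+\infty$.) **Condition C1.** For a metric space $\mathcal A$, a topological space $\mathcal Y$, a function $\eta:\mathcal A\times\mathcal Y\to\mathbb R$ and a non-negative Borel measure $\nu$ on $\mathcal Y$, the pair $(\eta,\nu)$ satisfies C1 if $\eta$ is continuous and there is a bounded measurable $h:\mathcal A\times\mathcal Y\to[0,\infty)$ with $\sup_{a\in\mathcal A}\int h(a,y)\,\nu(dy)<\infty$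 such that for every $\epsilon>0$ there is $\delta>0$ with $$|\eta(a,y)-\eta(a_0,y)|<\epsilon\,h(a_0,y)\quad\text{for all }y\in\mathcal Y\text{ and all }a,a_0\in\mathcal A\text{ with }d_{\mathcal A}(a,a_0)<\delta.$$ **Theorem.** Assume that 1. for every $i$, the cost $c$ belongs to $IC(\mathcal X\times\mathcal Y^{1:N},\mathcal U^i)$, where the remaining factor $\mathcal C$ is the product of the action spaces of the other agents; 2. some profile of behavioral strategies has finite expected cost; 3. the observations are conditionally independent given the state, $P(dy^{1:N}\mid x)=\prod_{i}P(dy^i\mid x)$, and there are non-negative Borel measures $\nu_{\mathcal X}$ on $\mathcal X$ and $\nu_{\mathcal Y^i}$ on $\mathcal Y^i$ and bounded continuous functions $\eta^i:\mathcal X\times\mathcal Y^i\to\mathbb R$ and $\rho^i:\mathcal Y^i\times\mathcal X\to\mathbb R$ such that, for every $i$, $$P(dy^i\mid x)=\eta^i(x,y^i)\,\nu_{\mathcal Y^i}(dy^i),\qquad P(dx\mid y^i)=\rho^i(y^i,x)\,\nu_{\mathcal X}(dx),$$ and the pairs $(\eta^i,\nu_{\mathcal Y^i})$ and $(\rho^i,\nu_{\mathcal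 X})$ satisfy C1. (Identities between conditional laws are understood for almost every value of the conditioning variable.) Then the team has an optimal solution in deterministic strategies: there are deterministic strategies $\gamma^1,\dots,\gamma^N$ with $$J(\gamma^1,\dots,\gamma^N)=\inf_{\pi^{1:N}}J(\pi^{1:N}),$$ where the infimum is over all profiles of behavioral strategies. -/

import Mathlib

open MeasureTheory ProbabilityTheory
open scoped NNReal ENNReal BoundedContinuousFunction

namespace StaticTeam

/-- `η (a, y) ν(dy)` is (a version of) the conditional law of `Z` given `V` under `P`, that is
`P(dy | a) = η (a, y) ν(dy)` for almost every value `a` of `V`. As `η` is real valued, its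
non-negativity (`ν`-almost everywhere) is recorded as a part of the identity. -/
def HasCondDensity {Ω A Y : Type*} [MeasurableSpace Ω] [MeasurableSpace A] [MeasurableSpace Y]
    [StandardBorelSpace Y] [Nonempty Y] (P : Measure Ω) [IsFiniteMeasure P]
    (V : Ω → A) (Z : Ω → Y) (η : A × Y → ℝ) (ν : Measure Y) : Prop :=
  ∀ᵐ a ∂(P.map V), (∀ᵐ y ∂ν, 0 ≤ η (a, y)) ∧
    condDistrib Z V P a = ν.withDensity (fun y => ENNReal.ofReal (η (a, y)))

/-- Condition C1 for the pair `(η, ν)`; the function `h` is the variation control function. -/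
def CondC1 {A Y : Type*} [MetricSpace A] [MeasurableSpace A] [TopologicalSpace Y]
    [MeasurableSpace Y] (η : A × Y → ℝ) (ν : Measure Y) : Prop :=
  Continuous η ∧
  ∃ h : A × Y → ℝ≥0, Measurable h ∧ BddAbove (Set.range h) ∧
    (⨆ a : A, ∫⁻ y, (h (a, y) : ℝ≥0∞) ∂ν) < ∞ ∧
    ∀ ε : ℝ, 0 < ε → ∃ δ : ℝ, 0 < δ ∧ ∀ a₀ a : A, dist a a₀ < δ →
      ∀ y : Y, |η (a, y) - η (a₀, y)| < ε * (h (a₀, y) : ℝ)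

/-- The class `IC(A, B)` of non-negative measurable functions `φ` on `A × B × C`. The bound
`inf φ ≥ M` over a product set is written pointwise (an infimum over the empty set is `+∞`). -/
def ClassIC {A B C : Type*} [TopologicalSpace A] [TopologicalSpace B] [MeasurableSpace A]
    [MeasurableSpace B] [MeasurableSpace C] (φ : A × B × C → ℝ) : Prop :=
  (∀ p, 0 ≤ φ p) ∧ Measurable φ ∧
  ((∀ M : ℝ, 0 < M → ∀ K : Set A, IsCompact K → ∃ L : Set B, IsCompact L ∧
      ∀ a ∈ K, ∀ b ∉ L, ∀ c : C, M ≤ φ (a, b, c)) ∨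
   (∀ M : ℝ, 0 < M → ∀ a₀ : A, ∃ O : Set A, IsOpen O ∧ a₀ ∈ O ∧ ∃ L : Set B, IsCompact L ∧
      ∀ a ∈ O, ∀ b ∉ L, ∀ c : C, M ≤ φ (a, b, c)))

/-- A behavioral strategy: a Markov (probability) kernel from observations to actions. -/
def BehavioralStrategy (Y U : Type*) [MeasurableSpace Y] [MeasurableSpace U] : Type _ :=
  {π : Kernel Y U // IsMarkovKernel π}

/-- A deterministic strategy: a Borel measurable map from observations to actions. -/
def DeterministicStrategy (Y U : Type*) [MeasurableSpace Y] [MeasurableSpace U] : Type _ :=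
  {γ : Y → U // Measurable γ}

/-- The behavioral strategy `y ↦ δ_{γ(y)}` induced by a deterministic strategy `γ`. -/
noncomputable def DeterministicStrategy.toBehavioral {Y U : Type*} [MeasurableSpace Y]
    [MeasurableSpace U] (γ : DeterministicStrategy Y U) : BehavioralStrategy Y U :=
  ⟨Kernel.deterministic γ.1 γ.2, inferInstance⟩

section Team

variable {N : ℕ} {X : Type*} {Y U : Fin N → Type*}

/-- The expected cost `J(π)`, with values in `[0, ∞]`, of a profile `π` of behavioral strategies:
`P` is the joint law of the state and of the observations, and given `(x, y)` the actions `u i` are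
drawn independently from `π i (· | y i)`. -/
noncomputable def expectedCost [MeasurableSpace X] [∀ i, MeasurableSpace (Y i)]
    [∀ i, MeasurableSpace (U i)] (P : Measure (X × (∀ i, Y i)))
    (c : X × (∀ i, Y i) × (∀ i, U i) → ℝ) (π : ∀ i, BehavioralStrategy (Y i) (U i)) : ℝ≥0∞ :=
  ∫⁻ p, ∫⁻ u, ENNReal.ofReal (c (p.1, p.2, u)) ∂(Measure.pi fun i => (π i).1 (p.2 i)) ∂P

/-- The function `c` on `X × Y × U` seen as a function on `(X × Y) × U i × U_{-i}`, where `U_{-i}`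
is the product of the action spaces of the agents other than `i`. -/
def splitAction (c : X × (∀ i, Y i) × (∀ i, U i) → ℝ) (i : Fin N) :
    (X × (∀ i, Y i)) × U i × (∀ j : {j // j ≠ i}, U j) → ℝ :=
  fun q => c (q.1.1, q.1.2, (Equiv.piSplitAt i U).symm q.2)

/-- The observations are conditionally independent given the state, `P(dy^i | x)` has a bounded
continuous density `η i` with respect to `νY i`, `P(dx | y^i)` has a bounded continuous density
`ρ i` with respect to `νX`, and all these pairs satisfy condition C1. -/
def CondIndC1 [MetricSpace X] [PolishSpace X] [MeasurableSpace X] [BorelSpace X] [Nonempty X]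
    [∀ i, MetricSpace (Y i)] [∀ i, PolishSpace (Y i)] [∀ i, MeasurableSpace (Y i)]
    [∀ i, BorelSpace (Y i)] [∀ i, Nonempty (Y i)]
    (P : Measure (X × (∀ i, Y i))) [IsProbabilityMeasure P] : Prop :=
  (∀ᵐ x ∂(P.map Prod.fst), condDistrib Prod.snd Prod.fst P x =
      Measure.pi fun i => condDistrib (fun p : X × (∀ i, Y i) => p.2 i) Prod.fst P x) ∧
  ∃ (νX : Measure X) (νY : ∀ i, Measure (Y i))
    (η : ∀ i, X × Y i →ᵇ ℝ) (ρ : ∀ i, Y i × X →ᵇ ℝ), ∀ i,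
      HasCondDensity P Prod.fst (fun p => p.2 i) (η i) (νY i) ∧
      HasCondDensity P (fun p => p.2 i) Prod.fst (ρ i) νX ∧
      CondC1 (η i) (νY i) ∧
      CondC1 (ρ i) νX

end Team

end StaticTeam

namespace StaticTeam

open Set Filter Topology

/-! ### Absolute continuity with respect to the product of the marginals -/

/-! The direct method applies once a strategy of agent `i` is encoded as the joint law `Q i` of its
observation and action, a measure whose first marginal is fixed. By
`CondIndC1.absolutelyContinuous`, `P` has a density `f` with respect to the product `m` of its
marginals. So `expectedCost_eq_lintegral_prod` writes the cost as the integral of `c * f` against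
the product of the law of the state and the `Q i`, and the product measure depends continuously on
the `Q i` in the weak topology.

The density `f` is merely integrable, but every admissible product measure has the same image `m` on
states and observations. Hence `f` can be replaced by bounded continuous functions with an error
uniform in the strategies, and the cost is lower semicontinuous
(`lowerSemicontinuousOn_lintegral_mul_comp`). The IC condition makes laws of bounded cost tight
(`exists_isCompact_law_mem`), so a minimiser exists; disintegration turns it back into behavioral
strategies.

Finally, writing actions as functions of the observation and independent noise, the cost is an
average of costs of deterministic profiles, one of which does no worse than the average. -/

lemma pi_absolutelyContinuous {n : ℕ} {α : Fin n → Type*} [∀ i, MeasurableSpace (α i)]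
    (μ ν : ∀ i, Measure (α i)) [∀ i, SigmaFinite (μ i)] [∀ i, SigmaFinite (ν i)]
    (h : ∀ i, μ i ≪ ν i) : Measure.pi μ ≪ Measure.pi ν := by
  induction n with
  | zero => rw [Measure.pi_of_empty μ, Measure.pi_of_empty ν]
  | succ n ih =>
    rw [← (measurePreserving_piFinSuccAbove μ 0).symm.map_eq,
      ← (measurePreserving_piFinSuccAbove ν 0).symm.map_eq]
    exact ((h 0).prod (ih _ _ fun i => h _)).map (MeasurableEquiv.measurable _)

/-- The mixture `κ ∘ₘ μ` has density `G b = ∫⁻ a, g (a, b) ∂μ` with respect to `ν`. Its zero set `Z`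
is null for the mixture, hence for almost every `κ a`; off `Z`, a set null for the mixture is
`ν`-null, hence `κ a`-null. -/
lemma ae_absolutelyContinuous_comp_of_withDensity {A B : Type*} [MeasurableSpace A]
    [MeasurableSpace B] (μ : Measure A) [SFinite μ] (κ : Kernel A B) (ν : Measure B) [SFinite ν]
    (g : A × B → ℝ≥0∞) (hg : Measurable g)
    (h : ∀ᵐ a ∂μ, κ a = ν.withDensity (fun b => g (a, b))) :
    ∀ᵐ a ∂μ, κ a ≪ κ ∘ₘ μ := by
  have hG : Measurable fun b => ∫⁻ a, g (a, b) ∂μ := hg.lintegral_prod_left'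
  have hbind : ∀ s, MeasurableSet s → (κ ∘ₘ μ) s = ∫⁻ b in s, ∫⁻ a, g (a, b) ∂μ ∂ν := by
    intro s hs
    rw [Measure.bind_apply hs κ.aemeasurable, lintegral_lintegral_swap (f := fun b a => g (a, b))
      (by exact (hg.comp measurable_swap).aemeasurable)]
    refine lintegral_congr_ae ?_
    filter_upwards [h] with a ha
    rw [ha, withDensity_apply _ hs]
  set Z := {b | ∫⁻ a, g (a, b) ∂μ = 0} with hZ
  have hZm : MeasurableSet Z := hG (measurableSet_singleton 0)
  have h0 : ∀ᵐ a ∂μ, κ a Z = 0 := by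
    have h1 : (κ ∘ₘ μ) Z = 0 := by
      rw [hbind Z hZm, setLIntegral_congr_fun hZm (g := fun _ => 0) (fun b hb => hb)]
      simp
    rw [Measure.bind_apply hZm κ.aemeasurable,
      lintegral_eq_zero_iff (κ.measurable_coe hZm)] at h1
    exact h1
  filter_upwards [h, h0] with a ha ha0
  refine Measure.AbsolutelyContinuous.mk fun s hs hs0 => ?_
  rw [hbind s hs, lintegral_eq_zero_iff hG, EventuallyEq, ae_restrict_iff' hs] at hs0
  have h2 : ν (s \ Z) = 0 := by
    refine measure_mono_null ?_ hs0
    intro b hb hb'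
    exact hb.2 (hb' hb.1)
  have h3 : κ a (s \ Z) = 0 := by
    rw [ha]; exact withDensity_absolutelyContinuous _ _ h2
  have := measure_le_inter_add_sdiff (κ a) s Z
  refine le_antisymm (this.trans ?_) zero_le
  rw [h3, add_zero, measure_mono_null inter_subset_right ha0]

/-- The strict inequality in C1 with `a = a₀` forces `h > 0`. So `ν` has density `h⁻¹` with respect
to the finite measure `h ν`. This permits Tonelli's theorem for `ν`. -/
lemma CondC1.sFinite {A Y : Type*} [MetricSpace A] [MeasurableSpace A] [Nonempty A]
    [TopologicalSpace Y] [MeasurableSpace Y] {η : A × Y → ℝ} {ν : Measure Y}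
    (h : CondC1 η ν) : SFinite ν := by
  obtain ⟨-, h, hm, -, hint, hvar⟩ := h
  obtain ⟨a⟩ := ‹Nonempty A›
  have hpos : ∀ y, 0 < h (a, y) := by
    intro y
    obtain ⟨δ, hδ, H⟩ := hvar 1 one_pos
    have := H a a (by simpa using hδ) y
    simpa using this
  have hm' : Measurable fun y => (h (a, y) : ℝ≥0∞) := by fun_prop
  have hfin : ∫⁻ y, (h (a, y) : ℝ≥0∞) ∂ν < ∞ :=
    (le_iSup (fun a => ∫⁻ y, (h (a, y) : ℝ≥0∞) ∂ν) a).trans_lt hint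
  have := isFiniteMeasure_withDensity hfin.ne
  rw [← withDensity_inv_same (μ := ν) hm' (ae_of_all _ fun y => by simpa using (hpos y).ne')
    (ae_of_all _ fun y => by simp)]
  infer_instance

/-- Disintegrate `P` along the state. Almost every fibre is a product by conditional independence,
and each factor is absolutely continuous with respect to the law of that observation, which is the
mixture of the factors. -/
lemma CondIndC1.absolutelyContinuous {N : ℕ} {X : Type*} {Y : Fin N → Type*}
    [MetricSpace X] [PolishSpace X] [MeasurableSpace X] [BorelSpace X] [Nonempty X]
    [∀ i, MetricSpace (Y i)] [∀ i, PolishSpace (Y i)] [∀ i, MeasurableSpace (Y i)]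
    [∀ i, BorelSpace (Y i)] [∀ i, Nonempty (Y i)]
    {P : Measure (X × (∀ i, Y i))} [IsProbabilityMeasure P] (hP : CondIndC1 P) :
    P ≪ (P.map Prod.fst).prod (Measure.pi fun i => P.map fun p => p.2 i) := by
  obtain ⟨hind, νX, νY, η, ρ, H⟩ := hP
  have hm : ∀ i, Measurable fun p : X × (∀ i, Y i) => p.2 i := fun i => by fun_prop
  have hpr : ∀ i, IsProbabilityMeasure (P.map fun p : X × (∀ i, Y i) => p.2 i) := fun i =>
    Measure.isProbabilityMeasure_map (hm i).aemeasurable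
  have : IsProbabilityMeasure (P.map Prod.fst) :=
    Measure.isProbabilityMeasure_map measurable_fst.aemeasurable
  have hac : ∀ᵐ x ∂(P.map Prod.fst), ∀ i,
      condDistrib (fun p : X × (∀ i, Y i) => p.2 i) Prod.fst P x ≪ P.map fun p => p.2 i := by
    rw [ae_all_iff]
    intro i
    have := (H i).2.2.1.sFinite
    rw [← condDistrib_comp_map (X := Prod.fst) (Y := fun p : X × (∀ i, Y i) => p.2 i) (μ := P)
      measurable_fst.aemeasurable (hm i).aemeasurable]
    refine ae_absolutelyContinuous_comp_of_withDensity _ _ (νY i)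
      (fun q => ENNReal.ofReal (η i q)) (by fun_prop) ?_
    filter_upwards [(H i).1] with x hx using hx.2
  have h1 : P = (P.map Prod.fst) ⊗ₘ condDistrib Prod.snd Prod.fst P := by
    rw [compProd_map_condDistrib measurable_snd.aemeasurable]
    exact Measure.map_id.symm
  rw [← Measure.compProd_const]
  nth_rewrite 1 [h1]
  refine Measure.AbsolutelyContinuous.compProd_right ?_
  filter_upwards [hind, hac] with x hx hx'
  rw [hx, Kernel.const_apply]
  exact pi_absolutelyContinuous _ _ hx'

/-! ### Lower semicontinuity of the cost when a marginal is fixed -/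

section Semicontinuity

variable {Z W : Type*} [TopologicalSpace Z] [MeasurableSpace Z] [BorelSpace Z]
  [TopologicalSpace W] [NormalSpace W] [MeasurableSpace W] [BorelSpace W]

/-- Replacing `f` by a bounded continuous `φ` changes the integral by at most `‖g‖` times the
`L¹(m)` distance, uniformly in `μ` because the image under `T` is fixed. A uniform limit of weakly
continuous functionals is continuous. -/
lemma continuousOn_integral_mul_comp {T : Z → W} (hT : Continuous T) {m : Measure W}
    [m.WeaklyRegular] {f : W → ℝ} (hf : Integrable f m) (g : Z →ᵇ ℝ) :
    ContinuousOn (fun μ : ProbabilityMeasure Z => ∫ z, g z * f (T z) ∂(μ : Measure Z))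
      {μ | (μ : Measure Z).map T = m} := by
  refine continuousOn_of_uniform_approx_of_continuousOn fun u hu => ?_
  obtain ⟨ε, hε, hεu⟩ := Metric.mem_uniformity_dist.1 hu
  obtain ⟨φ, hφ, hφi⟩ := hf.exists_boundedContinuous_integral_sub_le
    -- The `+ 1` keeps the denominator positive when `g = 0`.
    (ε := ε / (2 * (‖g‖ + 1))) (by positivity)
  let ψ : Z →ᵇ ℝ := g * φ.compContinuous ⟨T, hT⟩
  refine ⟨fun μ => ∫ z, ψ z ∂(μ : Measure Z),
    (ProbabilityMeasure.continuous_integral_boundedContinuousFunction ψ).continuousOn,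
    fun μ hμ => hεu ?_⟩
  have hμ : (μ : Measure Z).map T = m := hμ
  have hfT : Integrable (fun z => f (T z)) (μ : Measure Z) := by
    rw [← hμ] at hf
    exact hf.comp_measurable hT.measurable
  have hφT : Integrable (fun z => φ (T z)) (μ : Measure Z) := by
    rw [← hμ] at hφi
    exact hφi.comp_measurable hT.measurable
  have hgm : AEStronglyMeasurable g (μ : Measure Z) := g.continuous.measurable.aestronglyMeasurable
  have hgb : ∀ᵐ z ∂(μ : Measure Z), ‖g z‖ ≤ ‖g‖ := ae_of_all _ g.norm_coe_le_norm
  have e1 : ∫ z, g z * f (T z) ∂(μ : Measure Z) - ∫ z, ψ z ∂(μ : Measure Z)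
      = ∫ z, g z * (f (T z) - φ (T z)) ∂(μ : Measure Z) := by
    change _ - ∫ z, g z * φ (T z) ∂(μ : Measure Z) = _
    rw [← integral_sub (hfT.bdd_mul hgm hgb) (hφT.bdd_mul hgm hgb)]
    refine integral_congr_ae (ae_of_all _ fun z => ?_)
    simp [mul_sub]
  rw [Real.dist_eq, e1]
  calc ‖∫ z, g z * (f (T z) - φ (T z)) ∂(μ : Measure Z)‖
      ≤ ∫ z, ‖g z * (f (T z) - φ (T z))‖ ∂(μ : Measure Z) := norm_integral_le_integral_norm _
    _ ≤ ∫ z, ‖g‖ * ‖f (T z) - φ (T z)‖ ∂(μ : Measure Z) := by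
        refine integral_mono ((hfT.sub hφT).bdd_mul hgm hgb).norm
          ((hfT.sub hφT).norm.const_mul _) fun z => ?_
        simp only [norm_mul]
        gcongr
        exact g.norm_coe_le_norm z
    _ = ‖g‖ * ∫ w, ‖f w - φ w‖ ∂m := by
        rw [integral_const_mul, ← hμ, integral_map hT.measurable.aemeasurable]
        rw [hμ]
        exact (hf.sub hφi).norm.aestronglyMeasurable
    _ ≤ ‖g‖ * (ε / (2 * (‖g‖ + 1))) := by gcongr
    _ < ε := by
        have := norm_nonneg g
        rw [mul_div_assoc', div_lt_iff₀ (by positivity)]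
        nlinarith

/-- By monotone convergence the integral is the supremum over `k` of those with `c` truncated at
`k`, each continuous by the previous lemma. -/
lemma lowerSemicontinuousOn_lintegral_mul_comp {T : Z → W} (hT : Continuous T) {m : Measure W}
    [m.WeaklyRegular] {f : W → ℝ} (hfm : Measurable f) (hf : Integrable f m) (hf0 : ∀ w, 0 ≤ f w)
    {c : Z → ℝ} (hc : Continuous c) (hc0 : ∀ z, 0 ≤ c z) :
    LowerSemicontinuousOn (fun μ : ProbabilityMeasure Z =>
        ∫⁻ z, ENNReal.ofReal (c z) * ENNReal.ofReal (f (T z)) ∂(μ : Measure Z))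
      {μ | (μ : Measure Z).map T = m} := by
  let g : ℕ → Z →ᵇ ℝ := fun k => BoundedContinuousFunction.ofNormedAddCommGroup
    (fun z => min (c z) k) (by fun_prop) k fun z => by
      rw [Real.norm_eq_abs, abs_of_nonneg (le_min (hc0 z) k.cast_nonneg)]
      exact min_le_right _ _
  have hg : ∀ k z, g k z = min (c z) k := fun _ _ => rfl
  have hg0 : ∀ k z, 0 ≤ g k z := fun k z => le_min (hc0 z) k.cast_nonneg
  have hlsc : LowerSemicontinuousOn (fun μ : ProbabilityMeasure Z =>
      ⨆ k, ENNReal.ofReal (∫ z, g k z * f (T z) ∂(μ : Measure Z)))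
      {μ | (μ : Measure Z).map T = m} :=
    lowerSemicontinuousOn_iSup fun k =>
      (ENNReal.continuous_ofReal.comp_continuousOn
        (continuousOn_integral_mul_comp hT hf (g k))).lowerSemicontinuousOn
  suffices h : ∀ μ ∈ {μ : ProbabilityMeasure Z | (μ : Measure Z).map T = m},
      ∫⁻ z, ENNReal.ofReal (c z) * ENNReal.ofReal (f (T z)) ∂(μ : Measure Z)
        = ⨆ k, ENNReal.ofReal (∫ z, g k z * f (T z) ∂(μ : Measure Z)) by
    exact fun μ hμ => (hlsc μ hμ).congr_of_eventuallyEq hμ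
      (eventually_nhdsWithin_of_forall fun μ' hμ' _ => by simp only [h μ' hμ'])
  intro μ hμ
  have hμ : (μ : Measure Z).map T = m := hμ
  have hfT : Integrable (fun z => f (T z)) (μ : Measure Z) := by
    rw [← hμ] at hf
    exact hf.comp_measurable hT.measurable
  have hcm := hc.measurable
  have hTm := hT.measurable
  have hsup : ∀ z, ENNReal.ofReal (c z) * ENNReal.ofReal (f (T z))
      = ⨆ k, ENNReal.ofReal (g k z) * ENNReal.ofReal (f (T z)) := by
    intro z
    rw [← ENNReal.iSup_mul]
    congr 1
    refine le_antisymm ?_ (iSup_le fun k => ENNReal.ofReal_le_ofReal (min_le_left _ _))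
    obtain ⟨k, hk⟩ := exists_nat_ge (c z)
    refine le_iSup_of_le k ?_
    rw [hg, min_eq_left hk]
  simp_rw [hsup]
  rw [lintegral_iSup]
  · refine iSup_congr fun k => ?_
    rw [ofReal_integral_eq_lintegral_ofReal
      (hfT.bdd_mul (g k).continuous.measurable.aestronglyMeasurable
        (ae_of_all _ (g k).norm_coe_le_norm)) (ae_of_all _ fun z => mul_nonneg (hg0 k z) (hf0 _))]
    exact lintegral_congr fun z => (ENNReal.ofReal_mul (hg0 k z)).symm
  · intro k
    have := (g k).continuous.measurable
    fun_prop
  · intro k l hkl z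
    dsimp only
    gcongr
    rw [hg, hg]
    gcongr

end Semicontinuity

/-! ### The cost in terms of randomised deterministic strategies -/

lemma pi_prod_eq_map {ι : Type*} [Fintype ι] {A B : ι → Type*} [∀ i, MeasurableSpace (A i)]
    [∀ i, MeasurableSpace (B i)] (μ : ∀ i, Measure (A i)) (ν : ∀ i, Measure (B i))
    [∀ i, IsProbabilityMeasure (μ i)] [∀ i, IsProbabilityMeasure (ν i)] :
    Measure.pi (fun i => (μ i).prod (ν i)) =
      ((Measure.pi μ).prod (Measure.pi ν)).map (fun p i => (p.1 i, p.2 i)) := by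
  refine Measure.pi_eq_generateFrom (fun i => generateFrom_prod) (fun i => isPiSystem_prod)
    (fun i => ⟨fun _ => univ, fun _ => ⟨univ, MeasurableSet.univ, univ, MeasurableSet.univ,
      univ_prod_univ⟩, fun _ => measure_lt_top _ _, iUnion_const _⟩) fun s hs => ?_
  choose a ha b hb hab using hs
  obtain rfl : (fun i => a i ×ˢ b i) = s := funext hab
  have hpre : (fun (p : (∀ i, A i) × (∀ i, B i)) i => (p.1 i, p.2 i)) ⁻¹'
      (univ.pi fun i => a i ×ˢ b i) = univ.pi a ×ˢ univ.pi b := by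
    ext p
    simp [forall_and]
  rw [Measure.map_apply (by fun_prop) (MeasurableSet.univ_pi fun i => (ha i).prod (hb i)), hpre,
    Measure.prod_prod, Measure.pi_pi, Measure.pi_pi, ← Finset.prod_mul_distrib]
  simp_rw [Measure.prod_prod]

section Cost

variable {N : ℕ} {X : Type*} {Y U : Fin N → Type*} [MeasurableSpace X]
  [∀ i, MeasurableSpace (Y i)] [∀ i, MeasurableSpace (U i)]

/-- The measurable map `φ` realises the kernel `π` as the law of `φ (y, ω)`, `ω` being uniform. -/
def Realizes {Y U : Type*} [MeasurableSpace Y] [MeasurableSpace U] (φ : Y → unitInterval → U)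
    (π : BehavioralStrategy Y U) : Prop :=
  Measurable (Function.uncurry φ) ∧ ∀ y, volume.map (φ y) = π.1 y

lemma BehavioralStrategy.exists_realizes {Y U : Type*} [MeasurableSpace Y] [MeasurableSpace U]
    [StandardBorelSpace U] [Nonempty U] (π : BehavioralStrategy Y U) :
    ∃ φ : Y → unitInterval → U, Realizes φ π :=
  have := π.2
  π.1.exists_measurable_map_eq_unitInterval

lemma Realizes.measurable_apply {Y U : Type*} [MeasurableSpace Y] [MeasurableSpace U]
    {φ : Y → unitInterval → U} {π : BehavioralStrategy Y U} (h : Realizes φ π) (y : Y) :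
    Measurable (φ y) :=
  h.1.comp measurable_prodMk_left

lemma Realizes.compProd_eq_map {Y U : Type*} [MeasurableSpace Y] [MeasurableSpace U]
    {φ : Y → unitInterval → U} {π : BehavioralStrategy Y U} (h : Realizes φ π) (μ : Measure Y)
    [SFinite μ] :
    μ ⊗ₘ π.1 = (μ.prod volume).map (fun q => (q.1, φ q.1 q.2)) := by
  have := π.2
  have hm : Measurable fun q : Y × unitInterval => (q.1, φ q.1 q.2) := measurable_fst.prodMk h.1
  refine Measure.ext_of_lintegral _ fun g hg => ?_
  have hgm : Measurable fun q : Y × unitInterval => g (q.1, φ q.1 q.2) := hg.comp hm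
  rw [Measure.lintegral_compProd hg, lintegral_map hg hm, lintegral_prod _ hgm.aemeasurable]
  refine lintegral_congr fun y => ?_
  rw [← h.2 y, lintegral_map (by fun_prop) (h.measurable_apply y)]

lemma pi_behavioral_eq_map {π : ∀ i, BehavioralStrategy (Y i) (U i)}
    {φ : ∀ i, Y i → unitInterval → U i} (h : ∀ i, Realizes (φ i) (π i)) (y : ∀ i, Y i) :
    Measure.pi (fun i => (π i).1 (y i)) =
      (Measure.pi fun _ => volume).map (fun ω i => φ i (y i) (ω i)) := by
  have hm := fun i => (h i).measurable_apply (y i)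
  have : ∀ i, IsProbabilityMeasure (volume.map (φ i (y i))) := fun i =>
    Measure.isProbabilityMeasure_map (hm i).aemeasurable
  rw [Measure.pi_map_pi fun i => (hm i).aemeasurable]
  simp_rw [(h _).2]

lemma measurable_realization {π : ∀ i, BehavioralStrategy (Y i) (U i)}
    {φ : ∀ i, Y i → unitInterval → U i} (h : ∀ i, Realizes (φ i) (π i)) :
    Measurable fun q : (∀ i, Y i) × (Fin N → unitInterval) => fun i => φ i (q.1 i) (q.2 i) :=
  measurable_pi_lambda _ fun i => (h i).1.comp
    (((measurable_pi_apply i).comp measurable_fst).prodMk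
      ((measurable_pi_apply i).comp measurable_snd))

lemma expectedCost_eq_of_realizes (P : Measure (X × (∀ i, Y i)))
    {c : X × (∀ i, Y i) × (∀ i, U i) → ℝ} (hc : Measurable c)
    {π : ∀ i, BehavioralStrategy (Y i) (U i)}
    {φ : ∀ i, Y i → unitInterval → U i} (h : ∀ i, Realizes (φ i) (π i)) :
    expectedCost P c π = ∫⁻ p, ∫⁻ ω, ENNReal.ofReal (c (p.1, p.2, fun i => φ i (p.2 i) (ω i)))
      ∂(Measure.pi fun _ => volume) ∂P := by
  refine lintegral_congr fun p => ?_
  have hm : Measurable fun ω : Fin N → unitInterval => fun i => φ i (p.2 i) (ω i) :=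
    (measurable_realization h).comp measurable_prodMk_left
  rw [pi_behavioral_eq_map h, lintegral_map (by fun_prop) hm]

lemma expectedCost_toBehavioral (P : Measure (X × (∀ i, Y i)))
    {c : X × (∀ i, Y i) × (∀ i, U i) → ℝ} (hc : Measurable c)
    (γ : ∀ i, DeterministicStrategy (Y i) (U i)) :
    expectedCost P c (fun i => (γ i).toBehavioral) =
      ∫⁻ p, ENNReal.ofReal (c (p.1, p.2, fun i => (γ i).1 (p.2 i))) ∂P := by
  rw [expectedCost_eq_of_realizes (φ := fun i y _ => (γ i).1 y) P hc]
  · simp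
  · refine fun i => ⟨(γ i).2.comp measurable_fst, fun y => ?_⟩
    simp [DeterministicStrategy.toBehavioral, Kernel.deterministic_apply]

/-- Some profile of deterministic strategies does at least as well as a given behavioral one. -/
lemma exists_deterministic_expectedCost_le [∀ i, StandardBorelSpace (U i)] [∀ i, Nonempty (U i)]
    (P : Measure (X × (∀ i, Y i))) [SFinite P]
    {c : X × (∀ i, Y i) × (∀ i, U i) → ℝ} (hc : Measurable c)
    (π : ∀ i, BehavioralStrategy (Y i) (U i)) :
    ∃ γ : ∀ i, DeterministicStrategy (Y i) (U i),
      expectedCost P c (fun i => (γ i).toBehavioral) ≤ expectedCost P c π := by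
  choose φ hφ using fun i => (π i).exists_realizes
  have hm : Measurable fun q : (X × (∀ i, Y i)) × (Fin N → unitInterval) =>
      ENNReal.ofReal (c (q.1.1, q.1.2, fun i => φ i (q.1.2 i) (q.2 i))) := by
    have := (measurable_realization hφ).comp
      ((measurable_snd.comp measurable_fst).prodMk measurable_snd :
        Measurable fun q : (X × (∀ i, Y i)) × (Fin N → unitInterval) => (q.1.2, q.2))
    exact (hc.comp ((measurable_fst.comp measurable_fst).prodMk
      ((measurable_snd.comp measurable_fst).prodMk this))).ennreal_ofReal
  -- Freezing the noise `ω` leaves a deterministic profile; some `ω` costs no more than the mean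
  -- over `ω`.
  obtain ⟨ω, hω⟩ := exists_le_lintegral (μ := Measure.pi fun _ : Fin N => (volume :
    Measure unitInterval)) (f := fun ω => ∫⁻ p, ENNReal.ofReal
      (c (p.1, p.2, fun i => φ i (p.2 i) (ω i))) ∂P) hm.lintegral_prod_left'.aemeasurable
  let γ : ∀ i, DeterministicStrategy (Y i) (U i) := fun i =>
    ⟨fun y => φ i y (ω i), (hφ i).1.comp measurable_prodMk_right⟩
  refine ⟨γ, ?_⟩
  rw [expectedCost_toBehavioral P hc γ, expectedCost_eq_of_realizes P hc hφ,
    lintegral_lintegral_swap hm.aemeasurable]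
  exact hω

/-- The expected cost as an integral against a product measure, given a density of `P` with respect
to the product of its marginals. -/
lemma expectedCost_eq_lintegral_prod [∀ i, StandardBorelSpace (U i)] [∀ i, Nonempty (U i)]
    {P : Measure (X × (∀ i, Y i))} {μ : Measure X} [SFinite μ] {l : ∀ i, Measure (Y i)}
    [∀ i, IsProbabilityMeasure (l i)] {F : X × (∀ i, Y i) → ℝ≥0∞} (hF : Measurable F)
    (hP : P = (μ.prod (Measure.pi l)).withDensity F)
    {c : X × (∀ i, Y i) × (∀ i, U i) → ℝ} (hc : Measurable c)
    (π : ∀ i, BehavioralStrategy (Y i) (U i)) :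
    expectedCost P c π = ∫⁻ z, ENNReal.ofReal (c (z.1, fun i => (z.2 i).1, fun i => (z.2 i).2)) *
      F (z.1, fun i => (z.2 i).1) ∂(μ.prod (Measure.pi fun i => l i ⊗ₘ (π i).1)) := by
  have := fun i => (π i).2
  choose φ hφ using fun i => (π i).exists_realizes
  have hr := measurable_realization hφ
  have hcr : Measurable fun q : (X × (∀ i, Y i)) × (Fin N → unitInterval) =>
      ENNReal.ofReal (c (q.1.1, q.1.2, fun i => φ i (q.1.2 i) (q.2 i))) := by
    have := hr.comp
      ((measurable_snd.comp measurable_fst).prodMk measurable_snd :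
        Measurable fun q : (X × (∀ i, Y i)) × (Fin N → unitInterval) => (q.1.2, q.2))
    exact (hc.comp ((measurable_fst.comp measurable_fst).prodMk
      ((measurable_snd.comp measurable_fst).prodMk this))).ennreal_ofReal
  have hψ : ∀ i, Measurable fun q : Y i × unitInterval => (q.1, φ i q.1 q.2) := fun i =>
    measurable_fst.prodMk (hφ i).1
  -- With independent noise, the product of the laws is an image of (observations) × (noise), so
  -- both sides become iterated integrals over state, observations and noise.
  have hpi : Measure.pi (fun i => l i ⊗ₘ (π i).1) =
      ((Measure.pi l).prod (Measure.pi fun _ => volume)).map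
        (fun q i => (q.1 i, φ i (q.1 i) (q.2 i))) := by
    have : ∀ i, IsProbabilityMeasure
        (((l i).prod volume).map (fun q => (q.1, φ i q.1 q.2))) := fun i =>
      Measure.isProbabilityMeasure_map (hψ i).aemeasurable
    have hψ' : Measurable fun (q : ∀ i, Y i × unitInterval) i =>
        ((q i).1, φ i (q i).1 (q i).2) :=
      measurable_pi_lambda _ fun i => (hψ i).comp (measurable_pi_apply i)
    simp_rw [(hφ _).compProd_eq_map]
    rw [← Measure.pi_map_pi fun i => (hψ i).aemeasurable, pi_prod_eq_map,
      Measure.map_map hψ' (by fun_prop)]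
    rfl
  have hmq : Measurable fun q : (∀ i, Y i) × (Fin N → unitInterval) =>
      fun i => (q.1 i, φ i (q.1 i) (q.2 i)) :=
    measurable_pi_lambda _ fun i => (((measurable_pi_apply i).comp measurable_fst).prodMk
      ((measurable_pi_apply i).comp hr))
  have hG : Measurable fun z : X × (∀ i, Y i × U i) =>
      ENNReal.ofReal (c (z.1, fun i => (z.2 i).1, fun i => (z.2 i).2)) *
        F (z.1, fun i => (z.2 i).1) := by fun_prop
  rw [expectedCost_eq_of_realizes P hc hφ, hP,
    lintegral_withDensity_eq_lintegral_mul _ hF hcr.lintegral_prod_right', lintegral_prod _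
      (hF.mul hcr.lintegral_prod_right').aemeasurable, lintegral_prod _ hG.aemeasurable, hpi]
  refine lintegral_congr fun x => ?_
  have hGx : Measurable fun z : ∀ i, Y i × U i =>
      ENNReal.ofReal (c (x, fun i => (z i).1, fun i => (z i).2)) * F (x, fun i => (z i).1) :=
    hG.comp measurable_prodMk_left
  have hGq : Measurable fun q : (∀ i, Y i) × (Fin N → unitInterval) =>
      ENNReal.ofReal (c (x, q.1, fun i => φ i (q.1 i) (q.2 i))) * F (x, q.1) := hGx.comp hmq
  rw [lintegral_map hGx hmq, lintegral_prod _ hGq.aemeasurable]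
  refine lintegral_congr fun y => ?_
  rw [Pi.mul_apply, mul_comm]
  exact (lintegral_mul_const _ (hcr.comp measurable_prodMk_left)).symm

end Cost

/-! ### Compactness of the strategies of bounded cost -/

/-- The local alternative implies the compact one: finitely many of the neighborhoods cover `K`, and
the union of their compact sets serves as `L`. -/
lemma ClassIC.exists_isCompact {A B C : Type*} [TopologicalSpace A] [TopologicalSpace B]
    [MeasurableSpace A] [MeasurableSpace B] [MeasurableSpace C] {φ : A × B × C → ℝ}
    (h : ClassIC φ) {M : ℝ} (hM : 0 < M) {K : Set A} (hK : IsCompact K) :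
    ∃ L : Set B, IsCompact L ∧ ∀ a ∈ K, ∀ b ∉ L, ∀ c : C, M ≤ φ (a, b, c) := by
  obtain ⟨-, -, h | h⟩ := h
  · exact h M hM K hK
  choose O hO hmem L hL hle using h M hM
  obtain ⟨t, -, ht⟩ := hK.elim_nhds_subcover O fun a _ => (hO a).mem_nhds (hmem a)
  refine ⟨⋃ a ∈ t, L a, t.isCompact_biUnion fun a _ => hL a, fun a ha b hb c => ?_⟩
  obtain ⟨a₀, ha₀, haO⟩ := mem_iUnion₂.1 (ht ha)
  exact hle a₀ a haO b (fun hbL => hb (mem_iUnion₂.2 ⟨a₀, ha₀, hbL⟩)) c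

/-- The law of (observation, action) when the observation has law `l` and the agent uses `π`. -/
noncomputable def BehavioralStrategy.law {Y U : Type*} [MeasurableSpace Y] [MeasurableSpace U]
    (π : BehavioralStrategy Y U) (l : ProbabilityMeasure Y) : ProbabilityMeasure (Y × U) :=
  have := π.2
  ⟨(l : Measure Y) ⊗ₘ π.1, inferInstance⟩

lemma BehavioralStrategy.fst_law {Y U : Type*} [MeasurableSpace Y] [MeasurableSpace U]
    (π : BehavioralStrategy Y U) (l : ProbabilityMeasure Y) :
    ((π.law l : ProbabilityMeasure (Y × U)) : Measure (Y × U)).fst = l := by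
  have := π.2
  exact Measure.fst_compProd _ _

lemma exists_law_eq {Y U : Type*} [MeasurableSpace Y] [MeasurableSpace U]
    [StandardBorelSpace U] [Nonempty U] (l : ProbabilityMeasure Y)
    (Q : ProbabilityMeasure (Y × U)) (hQ : (Q : Measure (Y × U)).fst = l) :
    ∃ π : BehavioralStrategy Y U, π.law l = Q := by
  refine ⟨⟨(Q : Measure (Y × U)).condKernel, inferInstance⟩, Subtype.ext ?_⟩
  change (l : Measure Y) ⊗ₘ (Q : Measure (Y × U)).condKernel = Q
  rw [← hQ]
  exact Measure.disintegrate _ _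

variable {N : ℕ} {X : Type*} {Y U : Fin N → Type*}

/-- Markov's inequality for the action of agent `i` leaving `L`, when the cost is at least `M` off
`L` for states and observations in `K`. -/
lemma mul_setLIntegral_compl_le_expectedCost [MeasurableSpace X] [∀ i, MeasurableSpace (Y i)]
    [∀ i, MeasurableSpace (U i)] {P : Measure (X × (∀ i, Y i))}
    {c : X × (∀ i, Y i) × (∀ i, U i) → ℝ} (i : Fin N)
    {K : Set (X × (∀ i, Y i))} (hKm : MeasurableSet K) {L : Set (U i)} (hLm : MeasurableSet L)
    {M : ℝ} (hM : ∀ a ∈ K, ∀ b ∉ L, ∀ u, M ≤ splitAction c i (a, b, u))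
    (π : ∀ i, BehavioralStrategy (Y i) (U i)) :
    ENNReal.ofReal M * ∫⁻ p in K, (π i).1 (p.2 i) Lᶜ ∂P ≤ expectedCost P c π := by
  have hπ := fun i => (π i).2
  have hm : Measurable fun p : X × (∀ i, Y i) => (π i).1 (p.2 i) Lᶜ :=
    ((π i).1.measurable_coe hLm.compl).comp (by fun_prop)
  rw [← lintegral_const_mul _ hm, expectedCost]
  refine le_trans ?_ (setLIntegral_le_lintegral K _)
  refine setLIntegral_mono' hKm fun p hp => ?_
  have hpre := (measurePreserving_eval (fun i => (π i).1 (p.2 i)) i).measure_preimage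
    hLm.compl.nullMeasurableSet
  have hEm : MeasurableSet (Function.eval i ⁻¹' Lᶜ : Set (∀ i, U i)) :=
    measurable_pi_apply i hLm.compl
  rw [← hpre, ← setLIntegral_const]
  refine le_trans ?_ (setLIntegral_le_lintegral (Function.eval i ⁻¹' Lᶜ) _)
  refine setLIntegral_mono' hEm fun u hu => ENNReal.ofReal_le_ofReal ?_
  have := hM p hp (u i) hu fun j => u j
  have hu : (Equiv.piSplitAt i U).symm (u i, fun j => u j) = u :=
    (Equiv.piSplitAt i U).symm_apply_apply u
  rwa [splitAction, hu] at this

variable [MetricSpace X] [PolishSpace X] [MeasurableSpace X] [BorelSpace X]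
  [∀ i, MetricSpace (Y i)] [∀ i, PolishSpace (Y i)] [∀ i, MeasurableSpace (Y i)]
  [∀ i, BorelSpace (Y i)]
  [∀ i, TopologicalSpace (U i)] [∀ i, PolishSpace (U i)] [∀ i, MeasurableSpace (U i)]
  [∀ i, BorelSpace (U i)]

/-- Prokhorov's theorem: the observation marginal is fixed, hence tight. For the action marginal, a
compact `K` carries most of `P`, and over `K` Markov's inequality bounds the probability of leaving
`L`. -/
lemma exists_isCompact_law_mem (P : Measure (X × (∀ i, Y i))) [IsProbabilityMeasure P]
    {c : X × (∀ i, Y i) × (∀ i, U i) → ℝ} (i : Fin N) (hc : ClassIC (splitAction c i))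
    (l : ProbabilityMeasure (Y i)) (hl : (l : Measure (Y i)) = P.map fun p => p.2 i)
    {C : ℝ≥0∞} (hC : C ≠ ∞) :
    ∃ 𝒦 : Set (ProbabilityMeasure (Y i × U i)), IsCompact 𝒦 ∧
      ∀ π : ∀ i, BehavioralStrategy (Y i) (U i), expectedCost P c π ≤ C → (π i).law l ∈ 𝒦 := by
  let S : Set (ProbabilityMeasure (Y i × U i)) :=
    {Q | ∃ π : ∀ i, BehavioralStrategy (Y i) (U i), expectedCost P c π ≤ C ∧ (π i).law l = Q}
  refine ⟨closure S, isCompact_closure_of_isTightMeasureSet ?_,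
    fun π hπ => subset_closure ⟨π, hπ, rfl⟩⟩
  refine IsTightMeasureSet.prodMk ?_ ?_
  · refine (isTightMeasureSet_singleton (μ := (l : Measure (Y i)))).subset ?_
    rintro _ ⟨_, ⟨_, ⟨π, -, rfl⟩, rfl⟩, rfl⟩
    exact (π i).fst_law l
  rw [isTightMeasureSet_iff_exists_isCompact_measure_compl_le]
  intro ε hε
  -- Since `ε` may be `∞`, a finite `ε' < ε` takes its place.
  obtain ⟨ε', hε', hεε'⟩ := ENNReal.lt_iff_exists_nnreal_btwn.1 hε
  have hε'0 : 0 < (ε' : ℝ) := by exact_mod_cast hε'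
  obtain ⟨K, hK, hKε⟩ := isTightMeasureSet_iff_exists_isCompact_measure_compl_le.1
    (isTightMeasureSet_singleton (μ := P)) (ENNReal.ofReal (ε' / 2))
    (ENNReal.ofReal_pos.2 (by positivity))
  have hC0 : 0 ≤ C.toReal := ENNReal.toReal_nonneg
  -- This `M` gives `C / M ≤ ε' / 2`; the `+ 1` keeps it positive when `C = 0`.
  obtain ⟨L, hL, hLM⟩ := hc.exists_isCompact (M := 2 * (C.toReal + 1) / ε') (by positivity) hK
  refine ⟨L, hL, ?_⟩
  rintro _ ⟨_, ⟨_, ⟨π, hπ, rfl⟩, rfl⟩, rfl⟩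
  have hπi := (π i).2
  have h1 : (((π i).law l : ProbabilityMeasure (Y i × U i)) : Measure (Y i × U i)).snd Lᶜ
      = ∫⁻ p, (π i).1 (p.2 i) Lᶜ ∂P := by
    change ((l : Measure (Y i)) ⊗ₘ (π i).1).snd Lᶜ = _
    rw [Measure.snd_compProd, Measure.bind_apply hL.measurableSet.compl (Kernel.aemeasurable _), hl,
      lintegral_map ((π i).1.measurable_coe hL.measurableSet.compl) (by fun_prop)]
  have h2 : ∫⁻ p in K, (π i).1 (p.2 i) Lᶜ ∂P ≤ ENNReal.ofReal (ε' / 2) := by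
    have h := (mul_setLIntegral_compl_le_expectedCost i hK.measurableSet hL.measurableSet hLM
      π).trans hπ
    have hM0 : 0 < 2 * (C.toReal + 1) / (ε' : ℝ) := by positivity
    rw [mul_comm, ← ENNReal.le_div_iff_mul_le (Or.inl (ENNReal.ofReal_pos.2 hM0).ne')
      (Or.inl ENNReal.ofReal_ne_top)] at h
    refine h.trans ?_
    nth_rewrite 1 [← ENNReal.ofReal_toReal hC]
    rw [← ENNReal.ofReal_div_of_pos hM0]
    refine ENNReal.ofReal_le_ofReal ?_
    rw [div_le_iff₀ hM0]
    field_simp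
    linarith
  have h3 : ∫⁻ p in Kᶜ, (π i).1 (p.2 i) Lᶜ ∂P ≤ ENNReal.ofReal (ε' / 2) := by
    refine le_trans ?_ (hKε P rfl)
    rw [← setLIntegral_one]
    exact lintegral_mono fun p => prob_le_one
  rw [h1, ← lintegral_add_compl _ hK.measurableSet]
  refine (add_le_add h2 h3).trans ?_
  rw [← ENNReal.ofReal_add (by positivity) (by positivity), add_halves, ENNReal.ofReal_coe_nnreal]
  exact hεε'.le

/-! ### Existence of an optimal profile -/

lemma exists_isMinOn_expectedCost [∀ i, Nonempty (U i)]
    (P : Measure (X × (∀ i, Y i))) [IsProbabilityMeasure P]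
    (hac : P ≪ (P.map Prod.fst).prod (Measure.pi fun i => P.map fun p => p.2 i))
    {c : X × (∀ i, Y i) × (∀ i, U i) → ℝ} (hc0 : ∀ p, 0 ≤ c p) (hc : Continuous c)
    (hIC : ∀ i, ClassIC (splitAction c i))
    (hfin : ∃ π : ∀ i, BehavioralStrategy (Y i) (U i), expectedCost P c π < ∞) :
    ∃ π : ∀ i, BehavioralStrategy (Y i) (U i), ∀ π', expectedCost P c π ≤ expectedCost P c π' := by
  obtain ⟨π₀, hπ₀⟩ := hfin
  have hprX : IsProbabilityMeasure (P.map Prod.fst) :=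
    Measure.isProbabilityMeasure_map measurable_fst.aemeasurable
  have hprY : ∀ i, IsProbabilityMeasure (P.map fun p : X × (∀ i, Y i) => p.2 i) := fun i =>
    Measure.isProbabilityMeasure_map (by fun_prop)
  let lX : ProbabilityMeasure X := ⟨P.map Prod.fst, hprX⟩
  let l : ∀ i, ProbabilityMeasure (Y i) := fun i => ⟨P.map fun p => p.2 i, hprY i⟩
  let m : Measure (X × (∀ i, Y i)) :=
    (lX : Measure X).prod (Measure.pi fun i => (l i : Measure (Y i)))
  have hac : P ≪ m := hac
  let f : X × (∀ i, Y i) → ℝ := fun p => (P.rnDeriv m p).toReal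
  have hfm : Measurable f := (Measure.measurable_rnDeriv P m).ennreal_toReal
  have hfi : Integrable f m := Measure.integrable_toReal_rnDeriv
  have hPf : P = m.withDensity fun p => ENNReal.ofReal (f p) := by
    conv_lhs => rw [← Measure.withDensity_rnDeriv_eq P m hac]
    refine withDensity_congr_ae ?_
    filter_upwards [Measure.rnDeriv_lt_top P m] with p hp
    exact (ENNReal.ofReal_toReal hp.ne).symm
  let T : X × (∀ i, Y i × U i) → X × (∀ i, Y i) := fun z => (z.1, fun i => (z.2 i).1)
  let c' : X × (∀ i, Y i × U i) → ℝ := fun z => c (z.1, fun i => (z.2 i).1, fun i => (z.2 i).2)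
  let R : (∀ i, ProbabilityMeasure (Y i × U i)) →
      ProbabilityMeasure (X × (∀ i, Y i × U i)) := fun Q => lX.prod (ProbabilityMeasure.pi Q)
  have hR : Continuous R := ProbabilityMeasure.continuous_prod.comp
    (continuous_const.prodMk ProbabilityMeasure.continuous_pi)
  let J : (∀ i, ProbabilityMeasure (Y i × U i)) → ℝ≥0∞ := fun Q =>
    ∫⁻ z, ENNReal.ofReal (c' z) * ENNReal.ofReal (f (T z)) ∂(R Q : Measure (X × (∀ i, Y i × U i)))
  have hJ : ∀ π : ∀ i, BehavioralStrategy (Y i) (U i),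
      expectedCost P c π = J fun i => (π i).law (l i) := fun π =>
    expectedCost_eq_lintegral_prod hfm.ennreal_ofReal hPf hc.measurable π
  -- By disintegration, `S` consists exactly of the laws of behavioral profiles; it is closed
  -- because taking marginals is weakly continuous.
  let S : Set (∀ i, ProbabilityMeasure (Y i × U i)) :=
    {Q | ∀ i, (Q i : Measure (Y i × U i)).fst = l i}
  have hlsc : LowerSemicontinuousOn J S := by
    refine (lowerSemicontinuousOn_lintegral_mul_comp (T := T) (by fun_prop) hfm hfi
      (fun _ => ENNReal.toReal_nonneg) (c := c') (by fun_prop) fun _ => hc0 _).comp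
      hR.continuousOn fun Q hQ => ?_
    have hQ : ∀ i, (Q i : Measure (Y i × U i)).map Prod.fst = l i := hQ
    change ((lX : Measure X).prod (Measure.pi fun i => (Q i : Measure (Y i × U i)))).map T = m
    have hpr : ∀ i, IsProbabilityMeasure ((Q i : Measure (Y i × U i)).map Prod.fst) := fun i =>
      Measure.isProbabilityMeasure_map measurable_fst.aemeasurable
    have h1 : Measure.pi (fun i => (l i : Measure (Y i))) =
        (Measure.pi fun i => (Q i : Measure (Y i × U i))).map fun z i => (z i).1 := by
      rw [Measure.pi_map_pi fun i => measurable_fst.aemeasurable]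
      simp_rw [hQ]
    have h2 := Measure.map_prod_map (lX : Measure X)
      (Measure.pi fun i => (Q i : Measure (Y i × U i))) measurable_id
      (g := fun z i => (z i).1) (by fun_prop)
    rw [Measure.map_id, ← h1] at h2
    exact h2.symm
  choose 𝒦 h𝒦 hmem using fun i => exists_isCompact_law_mem P i (hIC i) (l i) rfl hπ₀.ne
  have hSc : IsClosed S := by
    have : S = ⋂ i, {Q | (Q i).map (f := Prod.fst) measurable_fst.aemeasurable = l i} := by
      ext Q
      simp only [S, mem_iInter, Set.mem_ofPred_eq]
      exact forall_congr' fun i => ⟨fun h => Subtype.ext h, fun h =>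
        congrArg ((↑) : ProbabilityMeasure (Y i) → Measure (Y i)) h⟩
    rw [this]
    exact isClosed_iInter fun i => isClosed_eq
      ((ProbabilityMeasure.continuous_map continuous_fst).comp (continuous_apply i))
      continuous_const
  have hcomp : IsCompact (univ.pi 𝒦 ∩ S) := (isCompact_univ_pi h𝒦).inter_right hSc
  have hlaw : ∀ π : ∀ i, BehavioralStrategy (Y i) (U i), expectedCost P c π ≤ expectedCost P c π₀ →
      (fun i => (π i).law (l i)) ∈ univ.pi 𝒦 ∩ S := fun π hπ =>
    ⟨fun i _ => hmem i π hπ, fun i => (π i).fst_law (l i)⟩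
  obtain ⟨Q, hQ, hmin⟩ := (hlsc.mono inter_subset_right).exists_isMinOn ⟨_, hlaw π₀ le_rfl⟩ hcomp
  choose π hπ using fun i => exists_law_eq (l i) (Q i) (hQ.2 i)
  have hle : ∀ π' : ∀ i, BehavioralStrategy (Y i) (U i),
      expectedCost P c π' ≤ expectedCost P c π₀ → expectedCost P c π ≤ expectedCost P c π' := by
    intro π' hπ'
    rw [hJ, hJ, funext hπ]
    exact hmin (hlaw π' hπ')
  -- Only competitors at most as costly as `π₀` are known to lie in the compact set; the others are
  -- compared through `π₀`.
  refine ⟨π, fun π' => ?_⟩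
  rcases le_total (expectedCost P c π') (expectedCost P c π₀) with h | h
  · exact hle π' h
  · exact (hle π₀ le_rfl).trans h

end StaticTeam

theorem mainTheorem4 {N : ℕ} {X : Type*} {Y U : Fin N → Type*}
    [MetricSpace X] [PolishSpace X] [SigmaCompactSpace X] [MeasurableSpace X] [BorelSpace X]
    [Nonempty X]
    [∀ i, MetricSpace (Y i)] [∀ i, PolishSpace (Y i)] [∀ i, SigmaCompactSpace (Y i)]
    [∀ i, MeasurableSpace (Y i)] [∀ i, BorelSpace (Y i)] [∀ i, Nonempty (Y i)]
    [∀ i, TopologicalSpace (U i)] [∀ i, PolishSpace (U i)] [∀ i, SigmaCompactSpace (U i)]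
    [∀ i, MeasurableSpace (U i)] [∀ i, BorelSpace (U i)]
    (P : Measure (X × (∀ i, Y i))) [IsProbabilityMeasure P]
    (c : X × (∀ i, Y i) × (∀ i, U i) → ℝ)
    (hc_nonneg : ∀ p, 0 ≤ c p) (hc_cont : Continuous c)
    (hc_IC : ∀ i, StaticTeam.ClassIC (StaticTeam.splitAction c i))
    (hfinite : ∃ π : ∀ i, StaticTeam.BehavioralStrategy (Y i) (U i),
      StaticTeam.expectedCost P c π < ∞)
    (hP : StaticTeam.CondIndC1 P) :
    ∃ γ : ∀ i, StaticTeam.DeterministicStrategy (Y i) (U i),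
      StaticTeam.expectedCost P c (fun i => (γ i).toBehavioral) =
        ⨅ π : ∀ i, StaticTeam.BehavioralStrategy (Y i) (U i), StaticTeam.expectedCost P c π := by
  -- A probability measure `π i (· | y)` exists on `U i`, so `U i` is non-empty.
  have hU : ∀ i, Nonempty (U i) := by
    intro i
    obtain ⟨π, -⟩ := hfinite
    obtain ⟨y⟩ := ‹∀ i, Nonempty (Y i)› i
    have := (π i).2
    exact nonempty_of_isProbabilityMeasure ((π i).1 y)
  obtain ⟨π, hπ⟩ := StaticTeam.exists_isMinOn_expectedCost P hP.absolutelyContinuous hc_nonneg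
    hc_cont hc_IC hfinite
  obtain ⟨γ, hγ⟩ := StaticTeam.exists_deterministic_expectedCost_le P hc_cont.measurable π
  exact ⟨γ, le_antisymm (le_iInf fun π' => hγ.trans (hπ π')) (iInf_le _ _)⟩
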